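/- A $d$-dimensional vector addition system (VAS), $d\in\mathbb N$, is a pair $V=(s,T)$ with $s\in\mathbb N^d$ and $T\subseteq\mathbb Z^d$ finite. Its reachability set is the set of all $v\in\mathbb N^d$ for which there are $n\ge 0$ and $v_0,\dots,v_n\in\mathbb N^d$ with $v_0=s$, $v_n=v$ and $v_{i+1}-v_i\in T$ for all $i<n$. A $d$-dimensional VAS with states (VASS) is a triple $V=(s,T,Q)$ with $Q$ a finite set of states, $s\in Q\times\mathbb N^d$ and $T\subseteq Q\times\mathbb Z^d\times Q$ finite. For $q\in Q$, its reachability set in state $q$ is the set of all $v\in\mathbb N^d$ for which there are $n\ge 0$ and $(q_0,v_0),\dots,(q_n,v_n)\in Q\times\mathbb N^d$ with $(q_0,v_0)=s$, $(q_n,v_n)=(q,v)$ and $(q_i,\,v_{i+1}-v_i,\,q_{i+1})\in T$ for all $i<n$. For $I\subseteq\{1,\dots,d\}$ let $\pi_I:\mathbb N^d\to\mathbb N^{|I|}$ delete the coordinates not in $I$; the section of $S\subseteq\mathbb N^d$ with respect to $I$ and $u\in\mathbb N^{d-|I|}$ is $\pi_I(\{v\in S : \pi_{\{1,\dots,d\}\setminus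 I}(v)=u\})\subseteq\mathbb N^{|I|}$. Let $\mathrm{Reach}(\mathrm{VAS})$ be the family of reachability sets of all VASes (in all dimensions), $\mathrm{Reach}(\mathrm{VASS})$ the family of reachability sets of all VASSes in all their states, and $\mathrm{SecReach}(\mathrm{VAS})$ the family of all sections of sets in $\mathrm{Reach}(\mathrm{VAS})$; a set of vectors is always taken together with its dimension. Proposition. $\mathrm{Reach}(\mathrm{VAS})\subsetneq\mathrm{Reach}(\mathrm{VASS})\subsetneq\mathrm{SecReach}(\mathrm{VAS})$. Moreover, the strictness of the first inclusion is not only due to the empty set: there is a non-empty set in $\mathrm{Reach}(\mathrm{VASS})$ that is not in $\mathrm{Reach}(\mathrm{VAS})$. -/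

import Mathlib

/-- Adding the integer vector `t` to the configuration `v` gives the configuration `w`
(so in particular no coordinate becomes negative). -/
def VecStep {d : ℕ} (v : Fin d → ℕ) (t : Fin d → ℤ) (w : Fin d → ℕ) : Prop :=
  ∀ i, (v i : ℤ) + t i = (w i : ℤ)

/-- A `d`-dimensional vector addition system: a source configuration and a finite set of
transitions. -/
structure VAS (d : ℕ) where
  source : Fin d → ℕ
  transitions : Finset (Fin d → ℤ)

namespace VAS

/-- One step of a partial run. -/
def Step {d : ℕ} (V : VAS d) (v w : Fin d → ℕ) : Prop :=
  ∃ t ∈ V.transitions, VecStep v t w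

/-- The reachability set: targets of all (finite, possibly empty) runs from the source. -/
def reach {d : ℕ} (V : VAS d) : Set (Fin d → ℕ) :=
  {v | Relation.ReflTransGen V.Step V.source v}

end VAS

/-- A `d`-dimensional vector addition system with states, with finite set of states `Q`. -/
structure VASS (d : ℕ) where
  Q : Type
  finiteStates : Finite Q
  source : Q × (Fin d → ℕ)
  transitions : Finset (Q × (Fin d → ℤ) × Q)

namespace VASS

/-- One step of a run. -/
def Step {d : ℕ} (V : VASS d) (c c' : V.Q × (Fin d → ℕ)) : Prop :=
  ∃ t : Fin d → ℤ, (c.1, t, c'.1) ∈ V.transitions ∧ VecStep c.2 t c'.2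

/-- The reachability set in state `q`: vectors `v` such that `(q, v)` is the target of a
(finite, possibly empty) run from the source. -/
def reach {d : ℕ} (V : VASS d) (q : V.Q) : Set (Fin d → ℕ) :=
  {v | Relation.ReflTransGen V.Step V.source (q, v)}

end VASS

/-- The `I`-projection of a vector: remove the coordinates outside `I`, keeping the order of the
remaining ones. -/
def vecProj {d : ℕ} (I : Finset (Fin d)) (v : Fin d → ℕ) : Fin I.card → ℕ :=
  fun j => v (I.orderEmbOfFin rfl j)

/-- The section of `S` with respect to `I` and `u`: fix the coordinates outside `I` to `u` and
project to the coordinates in `I`. -/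
def vecSection {d : ℕ} (I : Finset (Fin d)) (u : Fin Iᶜ.card → ℕ) (S : Set (Fin d → ℕ)) :
    Set (Fin I.card → ℕ) :=
  vecProj I '' {v ∈ S | vecProj Iᶜ v = u}

/-- A set of vectors of natural numbers, together with its dimension. -/
abbrev VecSet : Type := Σ d : ℕ, Set (Fin d → ℕ)

/-- The family of all reachability sets of vector addition systems. -/
def ReachVAS : Set VecSet :=
  {X | ∃ (d : ℕ) (V : VAS d), X = ⟨d, V.reach⟩}

/-- The family of all reachability sets, in some state, of vector addition systems with states. -/
def ReachVASS : Set VecSet :=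
  {X | ∃ (d : ℕ) (V : VASS d) (q : V.Q), X = ⟨d, V.reach q⟩}

/-- The family of all sections of reachability sets of vector addition systems. -/
def SecReachVAS : Set VecSet :=
  {X | ∃ (d : ℕ) (V : VAS d) (I : Finset (Fin d)) (u : Fin Iᶜ.card → ℕ),
    X = ⟨I.card, vecSection I u V.reach⟩}

/-!
A vector addition system with states is simulated by one without states that keeps the current
state in additional counters; reachability in a fixed state is then a section.

In dimension one, a transition of a vector addition system leading from `1` to `2` also leads from
`2` to `3`, so `{1, 2}` is not reachable without states.

The second inclusion is strict because a section of a three-dimensional VASS can have finite fibres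
over both axes and contain all points `(n, 2 ^ n - 1)`, whereas a two-dimensional VASS whose
reachability set has finite fibres satisfies a linear bound `y ≤ A * x + C`. Indeed, up to finitely
many exceptions, every run passes through one of finitely many configurations at which it can be
pumped. Pumping increases both counters, as it would otherwise create an infinite fibre, so that
afterwards every closed walk in the control graph can be realised. A closed walk leaning more
steeply upwards than an earlier rising one must itself be rising, since the two could otherwise be
combined into arbitrarily long vertical moves. Erasing the closed walks of a run one by one then
bounds its slope by the largest slope of a short rising cycle, up to the bounded contribution of a
simple path.
-/

open Relation

section FreshRuns

variable {α : Type*} {R r : α → α → Prop}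

theorem finite_setOf_reflTransGen (hwf : WellFounded (flip R)) (hfin : ∀ a, {b | R a b}.Finite)
    (a : α) : {b | ReflTransGen R a b}.Finite := by
  induction a using hwf.induction with
  | _ a ih =>
    refine ((Set.finite_singleton a).union ((hfin a).biUnion fun b hb => ih b hb)).subset ?_
    intro c hc
    rcases hc.cases_head with rfl | ⟨b, hab, hbc⟩
    · exact Or.inl rfl
    · exact Or.inr (Set.mem_biUnion hab hbc)

/-- One step of a run that records the set of elements visited so far, the current one included,
and stops before an element lying above an earlier one. -/
def FreshStep (R r : α → α → Prop) (x y : Set α × α) : Prop :=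
  R x.2 y.2 ∧ (∀ z ∈ x.1, ¬ r z y.2) ∧ y.1 = insert y.2 x.1

theorem wellFounded_flip_freshStep (hr : WellQuasiOrdered r) :
    WellFounded (flip (FreshStep R r)) := by
  refine wellFounded_iff_isEmpty_descending_chain.2 ⟨fun ⟨f, hf⟩ => ?_⟩
  have hmono : Monotone fun n => (f n).1 :=
    monotone_nat_of_le_succ fun n => (hf n).2.2 ▸ Set.subset_insert _ _
  obtain ⟨m, n, hmn, hle⟩ := hr fun n => (f (n + 1)).2
  have hvisited : (f (m + 1)).2 ∈ (f n).1 :=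
    hmono (Nat.succ_le_of_lt hmn) (by
      change (f (m + 1)).2 ∈ (f (m + 1)).1
      rw [(hf m).2.2]
      exact Set.mem_insert _ _)
  exact (hf n).2.1 _ hvisited hle

theorem finite_setOf_freshStep (hfin : ∀ a, {b | R a b}.Finite) (x : Set α × α) :
    {y | FreshStep R r x y}.Finite :=
  ((hfin x.2).image fun b => (insert b x.1, b)).subset fun y hy =>
    ⟨y.2, hy.1, Prod.ext hy.2.2.symm rfl⟩

theorem run_of_mem_visited {a : α} {x : Set α × α}
    (hx : ReflTransGen (FreshStep R r) ({a}, a) x) {z : α} (hz : z ∈ x.1) :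
    ReflTransGen R a z ∧ ReflTransGen R z x.2 ∧
      ∃ H, ReflTransGen (FreshStep R r) ({a}, a) (H, z) := by
  induction hx with
  | refl =>
    obtain rfl : z = a := hz
    exact ⟨.refl, .refl, _, .refl⟩
  | @tail x y hx hxy ih =>
    have hz' : z ∈ insert y.2 x.1 := hxy.2.2 ▸ hz
    rcases hz' with rfl | hz'
    · have hay : ReflTransGen R a y.2 :=
        ReflTransGen.lift Prod.snd (fun _ _ h => h.1) _ _ (hx.tail hxy)
      exact ⟨hay, .refl, y.1, hx.tail hxy⟩
    · obtain ⟨haz, hzx, hfresh⟩ := ih hz'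
      exact ⟨haz, hzx.tail hxy.1, hfresh⟩

/-- Kőnig's lemma turns well-quasi-ordering into finiteness: runs without repetitions reach only
finitely many elements, and a run with a repetition can be cut at the first one. -/
theorem exists_finite_mem_or_repetition (hr : WellQuasiOrdered r) (hfin : ∀ a, {b | R a b}.Finite)
    (a : α) :
    ∃ F : Set α, F.Finite ∧ ∀ b, ReflTransGen R a b → b ∈ F ∨ ∃ e ∈ F, ∃ e₀,
      ReflTransGen R a e₀ ∧ ReflTransGen R e₀ e ∧ ReflTransGen R e b ∧ r e₀ e ∧ e₀ ≠ e := by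
  set P := Prod.snd '' {x | ReflTransGen (FreshStep R r) ({a}, a) x}
  have hPfin : P.Finite := (finite_setOf_reflTransGen (wellFounded_flip_freshStep hr)
    (finite_setOf_freshStep hfin) _).image _
  set F := P ∪ ⋃ b ∈ P, {c | R b c}
  suffices ∀ b, ReflTransGen R a b → b ∈ P ∨ ∃ e ∈ F, ∃ e₀,
      ReflTransGen R a e₀ ∧ ReflTransGen R e₀ e ∧ ReflTransGen R e b ∧ r e₀ e ∧ e₀ ≠ e from
    ⟨F, hPfin.union (hPfin.biUnion fun b _ => hfin b), fun b hb =>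
      (this b hb).imp_left (Set.mem_union_left _)⟩
  intro b hb
  induction hb with
  | refl => exact Or.inl ⟨({a}, a), ReflTransGen.refl, rfl⟩
  | @tail b b' _ hbb' ih =>
    rcases ih with ⟨x, hx, rfl⟩ | ⟨e, he, e₀, h₀, h₁, h₂, hr'⟩
    · by_cases hfresh : ∀ z ∈ x.1, ¬ r z b'
      · exact Or.inl ⟨(insert b' x.1, b'), ReflTransGen.tail hx ⟨hbb', hfresh, rfl⟩, rfl⟩
      push Not at hfresh
      obtain ⟨e₀, he₀, hle⟩ := hfresh
      obtain ⟨hae₀, he₀x, H, hH⟩ := run_of_mem_visited hx he₀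
      by_cases heq : e₀ = b'
      · exact Or.inl ⟨(H, e₀), hH, heq⟩
      · exact Or.inr ⟨b', Or.inr (Set.mem_biUnion ⟨x, hx, rfl⟩ hbb'), e₀, hae₀, he₀x.tail hbb',
          .refl, hle, heq⟩
    · exact Or.inr ⟨e, he, e₀, h₀, h₁, h₂.tail hbb', hr'⟩

end FreshRuns

theorem le_add_mul_of_le_endpoints {m a b : ℤ} {j k : ℕ} (hjk : j ≤ k) (h₀ : m ≤ a)
    (hk : m ≤ a + k * b) : m ≤ a + j * b := by
  rcases le_total 0 b with hb | hb
  · exact h₀.trans (le_add_of_nonneg_right (by positivity))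
  · have : (k : ℤ) * b ≤ j * b := mul_le_mul_of_nonpos_right (by exact_mod_cast hjk) hb
    linarith

namespace VASS

variable {d : ℕ} {V : VASS d}

/-- The largest absolute value of a coordinate of a transition. -/
def norm (V : VASS d) : ℕ :=
  V.transitions.sup fun x => Finset.univ.sup fun i => (x.2.1 i).natAbs

theorem abs_le_norm {r r' : V.Q} {t : Fin d → ℤ} (ht : (r, t, r') ∈ V.transitions) (i : Fin d) :
    |t i| ≤ V.norm := by
  have h : (t i).natAbs ≤ V.norm :=
    (Finset.le_sup (f := fun i => (t i).natAbs) (Finset.mem_univ i)).trans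
      (Finset.le_sup (f := fun x : V.Q × (Fin d → ℤ) × V.Q =>
        Finset.univ.sup fun i => (x.2.1 i).natAbs) ht)
  rw [Int.abs_eq_natAbs]
  exact_mod_cast h

/-- `V.Walk n r g r'`: the control graph of `V` has a walk of length `n` from `r` to `r'` with
total effect `g`. Unlike along a run, counters may become negative along a walk. -/
inductive Walk (V : VASS d) : ℕ → V.Q → (Fin d → ℤ) → V.Q → Prop
  | nil (r : V.Q) : Walk V 0 r 0 r
  | cons {n : ℕ} {r r' r'' : V.Q} {t g : Fin d → ℤ} :
      (r, t, r') ∈ V.transitions → Walk V n r' g r'' → Walk V (n + 1) r (t + g) r''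

/-- Reachability in the control graph, ignoring the counters. -/
def Connected (V : VASS d) (r r' : V.Q) : Prop :=
  ∃ n g, V.Walk n r g r'

theorem Walk.trans {m n : ℕ} {r r' r'' : V.Q} {g h : Fin d → ℤ} (hg : V.Walk m r g r')
    (hh : V.Walk n r' h r'') : V.Walk (m + n) r (g + h) r'' := by
  induction hg with
  | nil => simpa only [zero_add] using hh
  | cons ht _ ih =>
    rw [Nat.add_right_comm, add_assoc (_ : Fin d → ℤ)]
    exact (ih hh).cons ht

theorem Walk.single {r r' : V.Q} {t : Fin d → ℤ} (ht : (r, t, r') ∈ V.transitions) :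
    V.Walk 1 r t r' := by
  simpa only [add_zero] using (Walk.nil r').cons ht

theorem Walk.connected {n : ℕ} {r r' : V.Q} {g : Fin d → ℤ} (h : V.Walk n r g r') :
    V.Connected r r' :=
  ⟨n, g, h⟩

theorem Connected.trans {r r' r'' : V.Q} (h : V.Connected r r') (h' : V.Connected r' r'') :
    V.Connected r r'' := by
  obtain ⟨_, _, hg⟩ := h
  obtain ⟨_, _, hh⟩ := h'
  exact (hg.trans hh).connected

theorem Walk.abs_le {n : ℕ} {r r' : V.Q} {g : Fin d → ℤ} (h : V.Walk n r g r') (i : Fin d) :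
    |g i| ≤ V.norm * n := by
  induction h with
  | nil => simp
  | @cons n _ _ _ t g ht _ ih =>
    calc |t i + g i| ≤ |t i| + |g i| := abs_add_le _ _
      _ ≤ V.norm + V.norm * n := add_le_add (abs_le_norm ht i) ih
      _ = V.norm * (n + 1 : ℕ) := by push_cast; ring

theorem exists_walk_of_run {c c' : V.Q × (Fin d → ℕ)} (h : ReflTransGen V.Step c c') :
    ∃ n g, V.Walk n c.1 g c'.1 ∧ VecStep c.2 g c'.2 := by
  induction h with
  | refl => exact ⟨0, 0, .nil _, fun i => add_zero _⟩
  | tail _ hs ih =>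
    obtain ⟨n, g, hwalk, hg⟩ := ih
    obtain ⟨t, ht, hs⟩ := hs
    exact ⟨n + 1, g + t, hwalk.trans (.single ht), fun i => by
      rw [← hs i, ← hg i, Pi.add_apply, add_assoc]⟩

theorem run_add {c c' : V.Q × (Fin d → ℕ)} (h : ReflTransGen V.Step c c') (w : Fin d → ℕ) :
    ReflTransGen V.Step (c.1, c.2 + w) (c'.1, c'.2 + w) := by
  refine ReflTransGen.lift (fun c : V.Q × (Fin d → ℕ) => (c.1, c.2 + w)) ?_ _ _ h
  rintro c c' ⟨t, ht, hs⟩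
  refine ⟨t, ht, fun i => ?_⟩
  have := hs i
  simp only [Pi.add_apply, Nat.cast_add]
  omega

theorem run_pump {p : V.Q} {v δ : Fin d → ℕ} (h : ReflTransGen V.Step (p, v) (p, v + δ)) (M : ℕ) :
    ReflTransGen V.Step (p, v) (p, v + M • δ) := by
  induction M with
  | zero => rw [zero_smul, add_zero]
  | succ M ih =>
    have hlast := run_add h (M • δ)
    rw [add_assoc, ← succ_nsmul'] at hlast
    exact ih.trans hlast

theorem add_nsmul_mem_reach {p q : V.Q} {v δ w : Fin d → ℕ} (hv : v ∈ V.reach p)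
    (hpump : ReflTransGen V.Step (p, v) (p, v + δ)) (hw : ReflTransGen V.Step (p, v) (q, w))
    (M : ℕ) : w + M • δ ∈ V.reach q :=
  (hv.trans (run_pump hpump M)).trans (run_add hw (M • δ))

/-- The vectors reachable in state `r`, as integer vectors. -/
def reachInt (V : VASS d) (r : V.Q) : Set (Fin d → ℤ) :=
  {z | ∃ v ∈ V.reach r, ∀ i, (v i : ℤ) = z i}

theorem add_mem_reachInt_of_walk {n : ℕ} {r r' : V.Q} {g z : Fin d → ℤ} (hz : z ∈ V.reachInt r)
    (h : V.Walk n r g r') (hle : ∀ i, V.norm * n ≤ z i) : z + g ∈ V.reachInt r' := by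
  induction h generalizing z with
  | nil => simpa only [add_zero] using hz
  | @cons n r r₁ r₂ t g ht _ ih =>
    have hle' : ∀ i, (V.norm : ℤ) * n ≤ (z + t) i := fun i => by
      have h₁ := hle i
      have h₂ := (abs_le.1 (abs_le_norm ht i)).1
      push_cast at h₁
      rw [Pi.add_apply]
      linarith
    have hnonneg : ∀ i, 0 ≤ (z + t) i := fun i => le_trans (by positivity) (hle' i)
    obtain ⟨v, hv, hvz⟩ := hz
    rw [← add_assoc]
    refine ih ⟨fun i => ((z + t) i).toNat, hv.tail ⟨t, ht, fun i => ?_⟩, fun i =>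
      Int.toNat_of_nonneg (hnonneg i)⟩ hle'
    rw [Int.toNat_of_nonneg (hnonneg i), hvz, Pi.add_apply]

theorem add_smul_mem_reachInt_of_cycle {n : ℕ} {r : V.Q} {g z : Fin d → ℤ}
    (hz : z ∈ V.reachInt r) (h : V.Walk n r g r) {k : ℕ} (h₀ : ∀ i, V.norm * n ≤ z i)
    (hk : ∀ i, V.norm * n ≤ z i + k * g i) : z + k • g ∈ V.reachInt r := by
  suffices ∀ j ≤ k, z + j • g ∈ V.reachInt r from this k le_rfl
  intro j hj
  induction j with
  | zero => simpa only [zero_smul, add_zero] using hz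
  | succ j ih =>
    rw [succ_nsmul, ← add_assoc]
    refine add_mem_reachInt_of_walk (ih (by omega)) h fun i => ?_
    simpa using le_add_mul_of_le_endpoints (by omega) (h₀ i) (hk i)

theorem exists_le_mem_reachInt {p : V.Q} {v δ : Fin d → ℕ} (hv : v ∈ V.reach p)
    (hpump : ReflTransGen V.Step (p, v) (p, v + δ)) (hδ : ∀ i, 0 < δ i) (B : ℕ) :
    ∃ z ∈ V.reachInt p, ∀ i, (B : ℤ) ≤ z i := by
  refine ⟨fun i => ((v + B • δ) i : ℕ), ⟨_, hv.trans (run_pump hpump B), fun _ => rfl⟩,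
    fun i => Nat.cast_le.2 ?_⟩
  exact (Nat.le_mul_of_pos_right B (hδ i)).trans (Nat.le_add_left _ _)

theorem add_add_smul_mem_reachInt {m n : ℕ} {r s : V.Q} {a g z : Fin d → ℤ}
    (hz : z ∈ V.reachInt r) (ha : V.Walk m r a s) (hg : V.Walk n s g s) {k : ℕ}
    (h₀ : ∀ i, V.norm * (m + n) ≤ z i) (hk : ∀ i, V.norm * (m + n) ≤ z i + k * g i) :
    z + a + k • g ∈ V.reachInt s := by
  have hlow := fun i => (abs_le.1 (ha.abs_le i)).1
  have hn : (0 : ℤ) ≤ V.norm * n := by positivity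
  simp only [mul_add] at h₀ hk
  refine add_smul_mem_reachInt_of_cycle (add_mem_reachInt_of_walk hz ha fun i => ?_) hg
    (fun i => ?_) fun i => ?_
  · linarith [h₀ i]
  · rw [Pi.add_apply]
    linarith [h₀ i, hlow i]
  · rw [Pi.add_apply]
    linarith [hk i, hlow i]

theorem exists_base_add_cycles_mem_reachInt {p r₁ r₂ q : V.Q} {v δ : Fin d → ℕ}
    (hv : v ∈ V.reach p) (hpump : ReflTransGen V.Step (p, v) (p, v + δ)) (hδ : ∀ i, 0 < δ i)
    {n₁ n₂ : ℕ} {g₁ g₂ : Fin d → ℤ} (h₁ : V.Walk n₁ r₁ g₁ r₁) (h₂ : V.Walk n₂ r₂ g₂ r₂)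
    (hp₁ : V.Connected p r₁) (h₁₂ : V.Connected r₁ r₂) (h₂q : V.Connected r₂ q) :
    ∃ z : Fin d → ℤ, ∀ k₁ k₂ : ℕ, (∀ i, 0 ≤ k₁ * g₁ i) → (∀ i, 0 ≤ k₁ * g₁ i + k₂ * g₂ i) →
      z + k₁ • g₁ + k₂ • g₂ ∈ V.reachInt q := by
  obtain ⟨na, a, ha⟩ := hp₁
  obtain ⟨nb, b, hb⟩ := h₁₂
  obtain ⟨nc, c, hc⟩ := h₂q
  have hnonneg : ∀ m : ℕ, (0 : ℤ) ≤ V.norm * m := fun m => by positivity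
  have hlow_a := fun i => (abs_le.1 (ha.abs_le i)).1
  have hlow_b := fun i => (abs_le.1 (hb.abs_le i)).1
  obtain ⟨z, hz, hhigh⟩ :=
    exists_le_mem_reachInt hv hpump hδ (V.norm * (na + n₁ + nb + n₂ + nc))
  push_cast [mul_add] at hhigh
  refine ⟨z + a + b + c, fun k₁ k₂ hk₁ hk₂ => ?_⟩
  have hreach₁ := add_add_smul_mem_reachInt (k := k₁) hz ha h₁
    (fun i => by linarith [hhigh i, hnonneg na, hnonneg nb, hnonneg nc, hnonneg n₂])
    (fun i => by linarith [hhigh i, hk₁ i, hnonneg na, hnonneg nb, hnonneg nc, hnonneg n₂])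
  have hreach₂ := add_add_smul_mem_reachInt (k := k₂) hreach₁ hb h₂
    (fun i => by
      simp only [nsmul_eq_mul, Pi.add_apply, Pi.mul_apply, Pi.natCast_apply]
      linarith [hhigh i, hk₁ i, hlow_a i, hnonneg na, hnonneg nb, hnonneg nc, hnonneg n₁])
    (fun i => by
      simp only [nsmul_eq_mul, Pi.add_apply, Pi.mul_apply, Pi.natCast_apply]
      linarith [hhigh i, hk₂ i, hlow_a i, hnonneg na, hnonneg nb, hnonneg nc, hnonneg n₁])
  have hreach := add_mem_reachInt_of_walk hreach₂ hc fun i => by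
    simp only [nsmul_eq_mul, Pi.add_apply, Pi.mul_apply, Pi.natCast_apply]
    linarith [hhigh i, hk₂ i, hlow_a i, hlow_b i, hnonneg na, hnonneg nb, hnonneg n₁, hnonneg n₂]
  convert hreach using 1
  abel

end VASS

theorem mul_le_mul_of_slope_le {a₀ a₁ c₀ c₁ x y : ℤ} (ha₀ : 0 < a₀) (hc₀ : 0 ≤ c₀) (hx : 0 ≤ x)
    (hy : a₀ * y ≤ a₁ * x) (hac : a₁ * c₀ ≤ a₀ * c₁) : c₀ * y ≤ c₁ * x := by
  refine le_of_mul_le_mul_left ?_ ha₀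
  calc a₀ * (c₀ * y) = c₀ * (a₀ * y) := by ring
    _ ≤ c₀ * (a₁ * x) := mul_le_mul_of_nonneg_left hy hc₀
    _ = a₁ * c₀ * x := by ring
    _ ≤ a₀ * c₁ * x := mul_le_mul_of_nonneg_right hac hx
    _ = a₀ * (c₁ * x) := by ring

namespace VASS

variable {d : ℕ} {V : VASS d}

theorem finite_setOf_step (V : VASS d) (c : V.Q × (Fin d → ℕ)) : {c' | V.Step c c'}.Finite := by
  refine (V.transitions.finite_toSet.image fun x =>
    (x.2.2, fun i => ((c.2 i : ℤ) + x.2.1 i).toNat)).subset ?_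
  rintro ⟨r, w⟩ ⟨t, ht, hs⟩
  exact ⟨_, ht, Prod.ext rfl (funext fun i => by simp [hs i])⟩

theorem wellQuasiOrdered_config (V : VASS d) :
    WellQuasiOrdered fun c c' : V.Q × (Fin d → ℕ) => c.1 = c'.1 ∧ c.2 ≤ c'.2 :=
  have := V.finiteStates
  (Finite.wellQuasiOrdered (· = ·)).prod wellQuasiOrdered_le

/-- A configuration reached by a run that starts from a reachable, strictly smaller configuration
in the same state, so that the run can be repeated. -/
def Pumpable (V : VASS d) (e : V.Q × (Fin d → ℕ)) : Prop :=
  ∃ v ∈ V.reach e.1, ReflTransGen V.Step (e.1, v) e ∧ v < e.2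

theorem exists_finite_mem_or_pumpable (V : VASS d) :
    ∃ F : Set (V.Q × (Fin d → ℕ)), F.Finite ∧ ∀ c, ReflTransGen V.Step V.source c →
      c ∈ F ∨ ∃ e ∈ F, V.Pumpable e ∧ ReflTransGen V.Step e c := by
  obtain ⟨F, hF, h⟩ := exists_finite_mem_or_repetition V.wellQuasiOrdered_config
    V.finite_setOf_step V.source
  refine ⟨F, hF, fun c hc => (h c hc).imp_right ?_⟩
  rintro ⟨⟨r, w⟩, he, ⟨_, v⟩, hv, hvw, hwc, ⟨rfl, hle⟩, hne⟩
  exact ⟨_, he, ⟨v, hv, hvw, lt_of_le_of_ne hle fun h => hne (by rw [h])⟩, hwc⟩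

theorem pos_of_finite_fibers {p q : V.Q} {v δ w : Fin d → ℕ}
    (hfib : ∀ i x, {u ∈ V.reach q | u i = x}.Finite) (hv : v ∈ V.reach p)
    (hpump : ReflTransGen V.Step (p, v) (p, v + δ)) (hw : ReflTransGen V.Step (p, v) (q, w))
    (hδ : δ ≠ 0) (i : Fin d) : 0 < δ i := by
  by_contra hi
  obtain ⟨j, hj⟩ := Function.ne_iff.1 hδ
  have hinj : Function.Injective fun M : ℕ => w + M • δ := fun M N h =>
    Nat.eq_of_mul_eq_mul_right (Nat.pos_of_ne_zero hj) (congrFun (add_left_cancel h) j)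
  refine Set.infinite_of_injective_forall_mem hinj (fun M => ?_) (hfib i (w i))
  exact ⟨add_nsmul_mem_reach hv hpump hw M, by simp [Nat.eq_zero_of_not_pos hi]⟩

/-- `V.SimplePath p l g r`: the control graph of `V` has a path from `p` to `r` with total effect
`g` that repeats no state; `l` lists the states before the last one, in reverse order. -/
inductive SimplePath (V : VASS d) (p : V.Q) : List V.Q → (Fin d → ℤ) → V.Q → Prop
  | nil : SimplePath V p [] 0 p
  | snoc {l : List V.Q} {r r' : V.Q} {g t : Fin d → ℤ} :
      SimplePath V p l g r → (r, t, r') ∈ V.transitions → r' ∉ r :: l →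
        SimplePath V p (r :: l) (g + t) r'

theorem SimplePath.walk {p r : V.Q} {l : List V.Q} {g : Fin d → ℤ} (h : V.SimplePath p l g r) :
    V.Walk l.length p g r := by
  induction h with
  | nil => exact .nil p
  | snoc _ ht _ ih => exact ih.trans (.single ht)

theorem SimplePath.length_lt_card {p r : V.Q} {l : List V.Q} {g : Fin d → ℤ}
    (h : V.SimplePath p l g r) : l.length < Nat.card V.Q := by
  have hnodup : (r :: l).Nodup := by
    induction h with
    | nil => exact List.nodup_singleton p
    | snoc _ _ hr ih => exact List.nodup_cons.2 ⟨hr, ih⟩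
  have := V.finiteStates
  exact hnodup.length_le_natCard

theorem SimplePath.abs_le {p r : V.Q} {l : List V.Q} {g : Fin d → ℤ} (h : V.SimplePath p l g r)
    (i : Fin d) : |g i| ≤ V.norm * Nat.card V.Q :=
  (h.walk.abs_le i).trans
    (mul_le_mul_of_nonneg_left (Nat.cast_le.2 h.length_lt_card.le) (Nat.cast_nonneg _))

theorem SimplePath.exists_split {p r u : V.Q} {l : List V.Q} {g : Fin d → ℤ}
    (h : V.SimplePath p l g r) (hu : u ∈ r :: l) :
    ∃ l' g' n h', V.SimplePath p l' g' u ∧ V.Walk n u h' r ∧ g = g' + h' ∧ n ≤ l.length := by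
  induction h with
  | nil =>
    obtain rfl := List.mem_singleton.1 hu
    exact ⟨[], 0, 0, 0, .nil, .nil u, (add_zero _).symm, le_rfl⟩
  | @snoc l r r' g t h ht hr ih =>
    rcases List.mem_cons.1 hu with rfl | hu
    · exact ⟨_, _, 0, 0, h.snoc ht hr, .nil u, (add_zero _).symm, Nat.zero_le _⟩
    · obtain ⟨l', g', n, h', hpath, hwalk, rfl, hn⟩ := ih hu
      exact ⟨l', g', n + 1, h' + t, hpath, hwalk.trans (.single ht), add_assoc _ _ _,
        Nat.succ_le_succ hn⟩

theorem SimplePath.exists_cycle {p r r' : V.Q} {l : List V.Q} {g t : Fin d → ℤ}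
    (h : V.SimplePath p l g r) (ht : (r, t, r') ∈ V.transitions) :
    ∃ l' g' n c, V.SimplePath p l' g' r' ∧ V.Walk n r' c r' ∧ n ≤ Nat.card V.Q ∧
      g + t = g' + c := by
  by_cases hr : r' ∈ r :: l
  · obtain ⟨l', g', n, h', hpath, hwalk, rfl, hn⟩ := h.exists_split hr
    exact ⟨l', g', n + 1, h' + t, hpath, hwalk.trans (.single ht),
      hn.trans_lt h.length_lt_card, add_assoc _ _ _⟩
  · exact ⟨_, _, 0, 0, h.snoc ht hr, .nil r', Nat.zero_le _, (add_zero _).symm⟩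

/-- Some walk from `p` to `r` passes through a cycle of effect `a` that moves to the right and
does not go down. -/
def RisingCycle (V : VASS 2) (p r : V.Q) (a : Fin 2 → ℤ) : Prop :=
  0 < a 0 ∧ 0 ≤ a 1 ∧ ∃ s n, V.Connected p s ∧ V.Walk n s a s ∧ V.Connected s r

section Plane

variable {V : VASS 2} {p q r : V.Q} {v δ : Fin 2 → ℕ}

/-- If the second cycle leaned more steeply upwards, the two could be combined into arbitrarily
long vertical moves. -/
theorem mul_le_mul_of_cycles {r₁ r₂ : V.Q}
    (hfib : ∀ x, {u ∈ V.reach q | u 0 = x}.Finite) (hv : v ∈ V.reach p)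
    (hpump : ReflTransGen V.Step (p, v) (p, v + δ)) (hδ : ∀ i, 0 < δ i)
    {n₁ n₂ : ℕ} {g h : Fin 2 → ℤ} (hg : V.Walk n₁ r₁ g r₁) (hh : V.Walk n₂ r₂ h r₂)
    (hp₁ : V.Connected p r₁) (h₁₂ : V.Connected r₁ r₂) (h₂q : V.Connected r₂ q)
    (hg₀ : 0 ≤ g 0) (hg₁ : 0 ≤ g 1) (hh₀ : h 0 ≤ 0) : g 0 * h 1 ≤ g 1 * h 0 := by
  by_contra! hlt
  obtain ⟨z, hz⟩ := exists_base_add_cycles_mem_reachInt hv hpump hδ hg hh hp₁ h₁₂ h₂q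
  obtain ⟨a, ha⟩ := Int.eq_ofNat_of_zero_le hg₀
  obtain ⟨b, hb⟩ := Int.eq_ofNat_of_zero_le (neg_nonneg.2 hh₀)
  have hvertical : ∀ k : ℕ, ∃ u ∈ V.reach q, (u 0 : ℤ) = z 0 ∧
      (u 1 : ℤ) = z 1 + k * (g 0 * h 1 - g 1 * h 0) := fun k => by
    obtain ⟨u, hu, huz⟩ := hz (k * b) (k * a)
      (Fin.forall_fin_two.2 ⟨by positivity, by positivity⟩)
      (Fin.forall_fin_two.2 ⟨by push_cast; rw [← ha, ← hb]; linarith, by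
        push_cast
        rw [← ha, ← hb]
        have : 0 ≤ k * (g 0 * h 1 - g 1 * h 0) :=
          mul_nonneg k.cast_nonneg (sub_nonneg.2 hlt.le)
        linarith⟩)
    refine ⟨u, hu, ?_, ?_⟩ <;>
    · rw [huz]
      simp only [nsmul_eq_mul, Pi.add_apply, Pi.mul_apply, Pi.natCast_apply]
      push_cast
      rw [← ha, ← hb]
      ring
  choose u hu hu₀ hu₁ using hvertical
  have hinj : Function.Injective u := fun k l hkl => by
    have : (k : ℤ) * (g 0 * h 1 - g 1 * h 0) = l * (g 0 * h 1 - g 1 * h 0) := by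
      linarith [hu₁ k, hu₁ l, congrArg (fun w : Fin 2 → ℕ => (w 1 : ℤ)) hkl]
    exact_mod_cast mul_right_cancel₀ (sub_pos.2 hlt).ne' this
  have hfibre : ∀ k, u k ∈ {w ∈ V.reach q | w 0 = u 0 0} := fun k =>
    ⟨hu k, by exact_mod_cast (hu₀ k).trans (hu₀ 0).symm⟩
  exact Set.infinite_of_injective_forall_mem hinj hfibre (hfib _)

theorem RisingCycle.trans {r' : V.Q} {a : Fin 2 → ℤ} (h : V.RisingCycle p r a)
    (hr : V.Connected r r') : V.RisingCycle p r' a := by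
  obtain ⟨h₀, h₁, s, n, hps, hwalk, hsr⟩ := h
  exact ⟨h₀, h₁, s, n, hps, hwalk, hsr.trans hr⟩

theorem exists_risingCycle_of_pump
    (hpump : ReflTransGen V.Step (p, v) (p, v + δ)) (hδ : ∀ i, 0 < δ i) :
    ∃ a, V.RisingCycle p p a ∧ ∀ i, a i = δ i := by
  obtain ⟨n, a, hwalk, ha⟩ := exists_walk_of_run hpump
  have ha : ∀ i, a i = δ i := fun i => by simpa using ha i
  refine ⟨a, ⟨?_, ?_, p, n, ⟨0, 0, .nil p⟩, hwalk, 0, 0, .nil p⟩, ha⟩ <;> rw [ha]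
  · exact Nat.cast_pos.2 (hδ 0)
  · exact Nat.cast_nonneg _

theorem RisingCycle.mul_le_mul_or_rises
    (hfib : ∀ x, {u ∈ V.reach q | u 0 = x}.Finite) (hv : v ∈ V.reach p)
    (hpump : ReflTransGen V.Step (p, v) (p, v + δ)) (hδ : ∀ i, 0 < δ i)
    {n : ℕ} {a c : Fin 2 → ℤ} (ha : V.RisingCycle p r a) (hc : V.Walk n r c r)
    (hrq : V.Connected r q) :
    a 0 * c 1 ≤ a 1 * c 0 ∨ 0 < c 0 ∧ 0 ≤ c 1 ∧ a 1 * c 0 ≤ a 0 * c 1 := by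
  obtain ⟨ha₀, ha₁, s, m, hps, hs, hsr⟩ := ha
  refine or_iff_not_imp_left.2 fun hlt => ?_
  rw [not_le] at hlt
  have hc₀ : 0 < c 0 := lt_of_not_ge fun hc₀ =>
    hlt.not_ge (mul_le_mul_of_cycles hfib hv hpump hδ hs hc hps hsr hrq ha₀.le ha₁ hc₀)
  exact ⟨hc₀, (pos_of_mul_pos_right ((mul_nonneg ha₁ hc₀.le).trans_lt hlt) ha₀.le).le, hlt.le⟩

theorem RisingCycle.exists_risingCycle_add_cycle
    (hfib : ∀ x, {u ∈ V.reach q | u 0 = x}.Finite) (hv : v ∈ V.reach p)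
    (hpump : ReflTransGen V.Step (p, v) (p, v + δ)) (hδ : ∀ i, 0 < δ i)
    {A x y : ℤ} (hA : V.norm * Nat.card V.Q ≤ A) {n : ℕ} {a c : Fin 2 → ℤ}
    (ha : V.RisingCycle p r a) (haA : a 1 ≤ A * a 0) (hx : 0 ≤ x) (hxy : a 0 * y ≤ a 1 * x)
    (hc : V.Walk n r c r) (hn : n ≤ Nat.card V.Q) (hrq : V.Connected r q) :
    ∃ a', V.RisingCycle p r a' ∧ a' 1 ≤ A * a' 0 ∧ a' 0 * (y + c 1) ≤ a' 1 * (x + c 0) := by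
  rcases ha.mul_le_mul_or_rises hfib hv hpump hδ hc hrq with hca | ⟨hc₀, hc₁, hca⟩
  · exact ⟨a, ha, haA, by linarith⟩
  · obtain ⟨ha₀, -, s, _, hps, -, hsr⟩ := ha
    refine ⟨c, ⟨hc₀, hc₁, r, n, hps.trans hsr, hc, 0, 0, .nil _⟩, ?_, ?_⟩
    · calc c 1 ≤ V.norm * n := (abs_le.1 (hc.abs_le 1)).2
        _ ≤ V.norm * Nat.card V.Q := by gcongr
        _ ≤ A := hA
        _ ≤ A * c 0 := le_mul_of_one_le_right (hA.trans' (by positivity)) hc₀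
    · linarith [mul_le_mul_of_slope_le ha₀ hc₀.le hx hxy hca]

/-- The displacement `γ` left after erasing cycles stays below the line through `(-B, 0)` whose
slope is that of the steepest rising cycle met so far. -/
theorem exists_risingCycle_of_run
    (hfib : ∀ x, {u ∈ V.reach q | u 0 = x}.Finite) (hv : v ∈ V.reach p)
    (hpump : ReflTransGen V.Step (p, v) (p, v + δ)) (hδ : ∀ i, 0 < δ i)
    {A B : ℤ} (hA : V.norm * Nat.card V.Q ≤ A) (hδA : δ 1 ≤ A)
    (hB : v 0 + V.norm * Nat.card V.Q ≤ B)
    {e : V.Q × (Fin 2 → ℕ)} (he : ReflTransGen V.Step (p, v) e) (heq : V.Connected e.1 q) :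
    ∃ l g γ a, V.SimplePath p l g e.1 ∧ VecStep v (g + γ) e.2 ∧ V.RisingCycle p e.1 a ∧
      a 1 ≤ A * a 0 ∧ a 0 * γ 1 ≤ a 1 * (γ 0 + B) := by
  have hA₀ : 0 ≤ A := hA.trans' (by positivity)
  induction he with
  | refl =>
    obtain ⟨a, ha, haδ⟩ := exists_risingCycle_of_pump hpump hδ
    refine ⟨[], 0, 0, a, .nil, fun i => by simp, ha, ?_, ?_⟩
    · calc a 1 ≤ A := (haδ 1).trans_le hδA
        _ ≤ A * a 0 := le_mul_of_one_le_right hA₀ ha.1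
    · simpa only [Pi.zero_apply, mul_zero, zero_add] using
        mul_nonneg ha.2.1 (hB.trans' (by positivity))
  | @tail e e' _ hstep ih =>
    obtain ⟨t, ht, hstep⟩ := hstep
    have hee' : V.Connected e.1 e'.1 := (Walk.single ht).connected
    obtain ⟨l, g, γ, a, hpath, hγ, ha, haA, hle⟩ := ih (hee'.trans heq)
    obtain ⟨l', g', n, c, hpath', hc, hn, hgc⟩ := hpath.exists_cycle ht
    have hγ' : VecStep v (g' + (γ + c)) e'.2 := fun i => by
      have h := congrFun hgc i
      have := hγ i
      have := hstep i
      simp only [Pi.add_apply] at *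
      linarith
    have hγB : 0 ≤ γ 0 + B := by
      have := hγ 0
      have := (abs_le.1 (hpath.abs_le 0)).2
      simp only [Pi.add_apply] at *
      linarith [Int.natCast_nonneg (e.2 0)]
    obtain ⟨a', ha', haA', hle'⟩ := (ha.trans hee').exists_risingCycle_add_cycle hfib hv hpump hδ
      hA haA hγB hle hc hn heq
    refine ⟨l', g', γ + c, a', hpath', hγ', ha', haA', ?_⟩
    rwa [Pi.add_apply, Pi.add_apply, add_right_comm]

theorem Pumpable.exists_linear_bound {e : V.Q × (Fin 2 → ℕ)}
    (he : V.Pumpable e) (hfib : ∀ i x, {u ∈ V.reach q | u i = x}.Finite) :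
    ∃ A C : ℕ, ∀ w, ReflTransGen V.Step e (q, w) → w 1 ≤ A * w 0 + C := by
  obtain ⟨v, hv, hrun, hlt⟩ := he
  obtain ⟨δ, hδ⟩ := exists_add_of_le hlt.le
  obtain ⟨p, _⟩ := e
  obtain rfl : _ = v + δ := hδ
  have hδ : δ ≠ 0 := by rintro rfl; exact hlt.ne (add_zero v).symm
  set N := V.norm * Nat.card V.Q with hN
  set A := max N (δ 1) with hA
  refine ⟨A, v 1 + N + A * (2 * N), fun w hw => ?_⟩
  have hpos := pos_of_finite_fibers hfib hv hrun (hrun.trans hw) hδ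
  obtain ⟨l, g, γ, a, hpath, hγ, ⟨ha, -⟩, haA, hle⟩ := exists_risingCycle_of_run (hfib 0) hv hrun
    hpos (A := A) (B := v 0 + N) (by rw [hA, hN]; push_cast; exact le_max_left _ _) (by simp [hA])
    (by simp [hN]) (hrun.trans hw) ⟨0, 0, .nil q⟩
  have hg := fun i => abs_le.1 (hpath.abs_le i)
  rw [← Nat.cast_mul, ← hN] at hg
  have hγ₀ : γ 0 + (v 0 + N) = w 0 - g 0 + N := by
    have := hγ 0
    simp only [Pi.add_apply] at this
    linarith
  have hγ₁ : γ 1 ≤ A * (w 0 + 2 * N) := by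
    refine le_of_mul_le_mul_left ?_ ha
    calc a 0 * γ 1 ≤ a 1 * (w 0 - g 0 + N) := by rwa [← hγ₀]
      _ ≤ A * a 0 * (w 0 - g 0 + N) :=
        mul_le_mul_of_nonneg_right haA (by linarith [(hg 0).2, Int.natCast_nonneg (w 0)])
      _ ≤ A * a 0 * (w 0 + 2 * N) :=
        mul_le_mul_of_nonneg_left (by linarith [(hg 0).1]) (by positivity)
      _ = a 0 * (A * (w 0 + 2 * N)) := by ring
  have := hγ 1
  simp only [Pi.add_apply] at this
  zify
  linarith [(hg 1).2]

theorem exists_linear_bound (hfib : ∀ i x, {u ∈ V.reach q | u i = x}.Finite) :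
    ∃ A C : ℕ, ∀ w ∈ V.reach q, w 1 ≤ A * w 0 + C := by
  obtain ⟨F, hF, hcover⟩ := V.exists_finite_mem_or_pumpable
  have hbound : ∀ e, ∃ A C : ℕ, ∀ w, e = (q, w) ∨ V.Pumpable e ∧ ReflTransGen V.Step e (q, w) →
      w 1 ≤ A * w 0 + C := fun e => by
    by_cases he : V.Pumpable e
    · obtain ⟨A, C, h⟩ := he.exists_linear_bound hfib
      exact ⟨A, C, fun w hw => h w (hw.elim (fun h => h ▸ .refl) And.right)⟩
    · refine ⟨0, e.2 1, fun w hw => ?_⟩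
      obtain rfl := hw.resolve_right fun h => he h.1
      simp
  choose A C hAC using hbound
  refine ⟨hF.toFinset.sup A, hF.toFinset.sup C, fun w hw => ?_⟩
  obtain ⟨e, he, hw⟩ : ∃ e ∈ F, e = (q, w) ∨ V.Pumpable e ∧ ReflTransGen V.Step e (q, w) := by
    rcases hcover _ hw with h | ⟨e, he, h⟩
    exacts [⟨_, h, Or.inl rfl⟩, ⟨e, he, Or.inr h⟩]
  calc w 1 ≤ A e * w 0 + C e := hAC e w hw
    _ ≤ hF.toFinset.sup A * w 0 + hF.toFinset.sup C := by
      gcongr <;> exact Finset.le_sup (hF.mem_toFinset.2 he)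

end Plane

end VASS

/-- The section of `S` with respect to the coordinates in the range of `ι` and to the values of `u`
elsewhere. Compared with `vecSection`, the dimension `d` is a variable and `u` is total. -/
def sectionAlong {d D : ℕ} (ι : Fin d ↪o Fin D) (u : Fin D → ℕ) (S : Set (Fin D → ℕ)) :
    Set (Fin d → ℕ) :=
  {v | ∃ w ∈ S, w ∘ ι = v ∧ ∀ i ∉ Set.range ι, w i = u i}

theorem sectionAlong_orderEmbOfFin {D : ℕ} (I : Finset (Fin D)) (u : Fin D → ℕ)
    (S : Set (Fin D → ℕ)) :
    sectionAlong (I.orderEmbOfFin rfl) u S = vecSection I (vecProj Iᶜ u) S := by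
  have hproj : ∀ w : Fin D → ℕ, vecProj Iᶜ w = vecProj Iᶜ u ↔ ∀ i ∉ I, w i = u i := fun w => by
    rw [funext_iff]
    change (∀ j, w (Iᶜ.orderEmbOfFin rfl j) = u (Iᶜ.orderEmbOfFin rfl j)) ↔ _
    rw [← Set.forall_mem_range (p := fun i => w i = u i), Finset.range_orderEmbOfFin]
    simp only [Finset.mem_coe, Finset.mem_compl]
  ext v
  simp only [sectionAlong, vecSection, Finset.range_orderEmbOfFin, Finset.mem_coe, hproj]
  exact ⟨fun ⟨w, hw, hv, hu⟩ => ⟨w, ⟨hw, hu⟩, hv⟩, fun ⟨w, ⟨hw, hu⟩, hv⟩ => ⟨w, hw, hv, hu⟩⟩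

theorem sectionAlong_mem_secReachVAS {d D : ℕ} (V : VAS D) (ι : Fin d ↪o Fin D) (u : Fin D → ℕ) :
    (⟨d, sectionAlong ι u V.reach⟩ : VecSet) ∈ SecReachVAS := by
  obtain ⟨I, hcard, rfl⟩ : ∃ (I : Finset (Fin D)) (h : I.card = d), ι = I.orderEmbOfFin h :=
    ⟨Finset.univ.map ι.toEmbedding, by simp, Finset.orderEmbOfFin_unique' _ fun i => by simp⟩
  subst hcard
  exact ⟨D, V, I, vecProj Iᶜ u, by rw [sectionAlong_orderEmbOfFin]⟩

theorem sectionAlong_sectionAlong {d k D : ℕ} (ι : Fin d ↪o Fin k) (κ : Fin k ↪o Fin D)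
    (u : Fin k → ℕ) (u' : Fin D → ℕ) (S : Set (Fin D → ℕ)) :
    sectionAlong ι u (sectionAlong κ u' S) =
      sectionAlong (ι.trans κ) (Function.extend κ u u') S := by
  ext v
  constructor
  · rintro ⟨_, ⟨w, hw, rfl, hu'⟩, rfl, hu⟩
    refine ⟨w, hw, rfl, fun i hi => ?_⟩
    by_cases hiκ : i ∈ Set.range κ
    · obtain ⟨j, rfl⟩ := hiκ
      rw [κ.injective.extend_apply]
      exact hu j fun ⟨m, hm⟩ => hi ⟨m, congrArg κ hm⟩
    · rw [Function.extend_apply' _ _ _ hiκ, hu' i hiκ]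
  · rintro ⟨w, hw, rfl, hu⟩
    refine ⟨w ∘ κ, ⟨w, hw, rfl, fun i hi => ?_⟩, rfl, fun j hj => ?_⟩
    · rw [hu i fun ⟨m, hm⟩ => hi ⟨ι m, hm⟩, Function.extend_apply' _ _ _ hi]
    · rw [Function.comp_apply, hu (κ j) fun ⟨m, hm⟩ => hj ⟨m, κ.injective hm⟩,
        κ.injective.extend_apply]

theorem mem_sectionAlong_castAdd {d K : ℕ} {u : Fin (d + K) → ℕ} {S : Set (Fin (d + K) → ℕ)}
    {v : Fin d → ℕ} :
    v ∈ sectionAlong (Fin.castAddOrderEmb K) u S ↔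
      Fin.append v (fun j => u (Fin.natAdd d j)) ∈ S := by
  have hrange : ∀ i, Fin.natAdd d i ∉ Set.range (Fin.castAddOrderEmb (n := d) K) := fun i ⟨j, hj⟩ =>
    (Nat.lt_add_right i j.isLt).ne (congrArg Fin.val hj)
  constructor
  · rintro ⟨w, hw, rfl, hu⟩
    rw [← Fin.append_castAdd_natAdd (f := w)] at hw
    rwa [funext fun j => (hu _ (hrange j)).symm]
  · refine fun h => ⟨_, h, funext fun i => Fin.append_left _ _ i, fun i => ?_⟩
    refine Fin.addCases (fun i hi => (hi ⟨i, rfl⟩).elim) (fun j _ => Fin.append_right _ _ j) i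

theorem append_eq_append_iff {α : Type*} {m n : ℕ} {v v' : Fin m → α} {w w' : Fin n → α} :
    Fin.append v w = Fin.append v' w' ↔ v = v' ∧ w = w' := by
  simp only [funext_iff, Fin.forall_fin_add, Fin.append_left, Fin.append_right]

theorem VecStep.right_unique {d : ℕ} {v w w' : Fin d → ℕ} {t : Fin d → ℤ} (h : VecStep v t w)
    (h' : VecStep v t w') : w = w' :=
  funext fun i => Nat.cast_injective (R := ℤ) ((h i).symm.trans (h' i))

theorem vecStep_zero {d : ℕ} {v w : Fin d → ℕ} : VecStep v 0 w ↔ w = v := by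
  have h : VecStep v 0 v := fun i => add_zero _
  exact ⟨fun h' => h'.right_unique h, fun hw => hw ▸ h⟩

theorem vecStep_append {d K : ℕ} {v w : Fin d → ℕ} {t : Fin d → ℤ} {v' w' : Fin K → ℕ}
    {t' : Fin K → ℤ} :
    VecStep (Fin.append v v') (Fin.append t t') (Fin.append w w') ↔
      VecStep v t w ∧ VecStep v' t' w' := by
  simp only [VecStep, Fin.forall_fin_add, Fin.append_left, Fin.append_right]

theorem vecStep_single {K : ℕ} {a b c : Fin K} {w : Fin K → ℕ} (hbc : b ≠ c) :
    VecStep (Pi.single a 1) (Pi.single c 1 - Pi.single b 1) w ↔ a = b ∧ w = Pi.single c 1 := by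
  have hmove : VecStep (Pi.single a 1) (Pi.single c 1 - Pi.single a 1) (Pi.single c 1) := by
    intro i
    simp only [Pi.sub_apply, Pi.single_apply]
    push_cast
    ring
  refine ⟨fun h => ?_, fun ⟨hab, hw⟩ => hw ▸ hab ▸ hmove⟩
  obtain rfl : a = b := by
    by_contra hab
    have := h b
    simp [hbc, Ne.symm hab] at this
  exact ⟨rfl, h.right_unique hmove⟩

namespace VASS

variable {d : ℕ}

/-- The index of the counter of `V.toVAS` that is `1` while `V` is in state `q`. The two counters
of a state are used alternately: with a single one, a loop `(q, t, q)` would have no effect on the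
state counters and could be taken in every state. -/
noncomputable def stateIndex (V : VASS d) : V.Q × Bool ≃ Fin (Nat.card (V.Q × Bool)) :=
  haveI := V.finiteStates
  Finite.equivFin _

/-- The configuration `c` as a vector: the counters followed by the unit vector of the state. -/
noncomputable def encode (V : VASS d) (c : V.Q × (Fin d → ℕ)) (b : Bool) :
    Fin (d + Nat.card (V.Q × Bool)) → ℕ :=
  Fin.append c.2 (Pi.single (V.stateIndex (c.1, b)) 1)

/-- The vector addition system simulating `V`: it moves the token of a state from its first to its
second counter, and then takes a transition from that state. -/
noncomputable def toVAS (V : VASS d) : VAS (d + Nat.card (V.Q × Bool)) where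
  source := V.encode V.source false
  transitions :=
    haveI := V.finiteStates
    ((Set.finite_range fun q : V.Q => Fin.append 0
        (Pi.single (V.stateIndex (q, true)) 1 - Pi.single (V.stateIndex (q, false)) 1)).union
      (V.transitions.finite_toSet.image fun x => Fin.append x.2.1
        (Pi.single (V.stateIndex (x.2.2, false)) 1 - Pi.single (V.stateIndex (x.1, true)) 1)))
      |>.toFinset

theorem encode_inj {V : VASS d} {c c' : V.Q × (Fin d → ℕ)} {b b' : Bool} :
    V.encode c b = V.encode c' b' ↔ c = c' ∧ b = b' := by
  have hsingle : ∀ i j : Fin (Nat.card (V.Q × Bool)),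
      (Pi.single i 1 : _ → ℕ) = Pi.single j 1 ↔ i = j := fun i j => by
    refine ⟨fun h => ?_, fun h => h ▸ rfl⟩
    by_contra hij
    simpa [hij] using congrFun h i
  rw [encode, encode, append_eq_append_iff, hsingle, V.stateIndex.apply_eq_iff_eq, Prod.mk.injEq,
    Prod.ext_iff]
  tauto

theorem toVAS_step_append_single {V : VASS d} {v v' : Fin d → ℕ}
    {i : Fin (Nat.card (V.Q × Bool))} {w : Fin (Nat.card (V.Q × Bool)) → ℕ} :
    V.toVAS.Step (Fin.append v (Pi.single i 1)) (Fin.append v' w) ↔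
      (∃ q, i = V.stateIndex (q, false) ∧ v' = v ∧ w = Pi.single (V.stateIndex (q, true)) 1) ∨
      ∃ x ∈ V.transitions, i = V.stateIndex (x.1, true) ∧ VecStep v x.2.1 v' ∧
        w = Pi.single (V.stateIndex (x.2.2, false)) 1 := by
  have hne₁ : ∀ q q', V.stateIndex (q, false) ≠ V.stateIndex (q', true) := by simp
  have hne₂ : ∀ q q', V.stateIndex (q, true) ≠ V.stateIndex (q', false) := by simp
  simp only [VAS.Step, toVAS, Set.Finite.mem_toFinset, Set.mem_union, Set.mem_range, Set.mem_image,
    Finset.mem_coe, or_and_right, exists_or, exists_exists_eq_and, exists_exists_and_eq_and,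
    vecStep_append, vecStep_single (hne₁ _ _), vecStep_single (hne₂ _ _), vecStep_zero]
  simp only [and_left_comm]

theorem toVAS_step_encode_false {V : VASS d} {c : V.Q × (Fin d → ℕ)}
    {w : Fin (d + Nat.card (V.Q × Bool)) → ℕ} :
    V.toVAS.Step (V.encode c false) w ↔ w = V.encode c true := by
  obtain ⟨w₁, w₂, rfl⟩ : ∃ w₁ w₂, w = Fin.append w₁ w₂ := ⟨_, _, Fin.append_castAdd_natAdd.symm⟩
  simp [encode, toVAS_step_append_single, append_eq_append_iff]

theorem toVAS_step_encode_true {V : VASS d} {c : V.Q × (Fin d → ℕ)}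
    {w : Fin (d + Nat.card (V.Q × Bool)) → ℕ} :
    V.toVAS.Step (V.encode c true) w ↔ ∃ c', V.Step c c' ∧ w = V.encode c' false := by
  obtain ⟨w₁, w₂, rfl⟩ : ∃ w₁ w₂, w = Fin.append w₁ w₂ := ⟨_, _, Fin.append_castAdd_natAdd.symm⟩
  rw [encode, toVAS_step_append_single]
  constructor
  · rintro (⟨q, h, -⟩ | ⟨⟨p, t, q⟩, ht, h, hs, rfl⟩)
    · simp at h
    · obtain rfl : c.1 = p := by simpa using h
      exact ⟨(q, w₁), ⟨t, ht, hs⟩, rfl⟩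
  · rintro ⟨c', ⟨t, ht, hs⟩, h⟩
    obtain ⟨rfl, rfl⟩ := append_eq_append_iff.1 h
    exact Or.inr ⟨_, ht, rfl, hs, rfl⟩

theorem mem_toVAS_reach {V : VASS d} {w : Fin (d + Nat.card (V.Q × Bool)) → ℕ} :
    w ∈ V.toVAS.reach ↔ ∃ c b, ReflTransGen V.Step V.source c ∧ w = V.encode c b := by
  constructor
  · intro hw
    induction hw with
    | refl => exact ⟨V.source, false, .refl, rfl⟩
    | tail _ hs ih =>
      obtain ⟨c, b, hc, rfl⟩ := ih
      cases b with
      | false => exact ⟨c, true, hc, toVAS_step_encode_false.1 hs⟩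
      | true =>
        obtain ⟨c', hcc', rfl⟩ := toVAS_step_encode_true.1 hs
        exact ⟨c', false, hc.tail hcc', rfl⟩
  · rintro ⟨c, b, hc, rfl⟩
    have hfalse : V.encode c false ∈ V.toVAS.reach := by
      induction hc with
      | refl => exact .refl
      | tail _ hs ih =>
        exact (ih.tail (toVAS_step_encode_false.2 rfl)).tail (toVAS_step_encode_true.2 ⟨_, hs, rfl⟩)
    cases b with
    | false => exact hfalse
    | true => exact hfalse.tail (toVAS_step_encode_false.2 rfl)

theorem encode_mem_toVAS_reach {V : VASS d} {q : V.Q} {v : Fin d → ℕ} :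
    V.encode (q, v) false ∈ V.toVAS.reach ↔ v ∈ V.reach q := by
  rw [mem_toVAS_reach]
  refine ⟨?_, fun h => ⟨_, _, h, rfl⟩⟩
  rintro ⟨c, b, hc, h⟩
  obtain ⟨rfl, -⟩ := encode_inj.1 h
  exact hc

theorem reach_eq_sectionAlong (V : VASS d) (q : V.Q) :
    V.reach q = sectionAlong (Fin.castAddOrderEmb _) (V.encode (q, 0) false) V.toVAS.reach := by
  ext v
  rw [mem_sectionAlong_castAdd, ← encode_mem_toVAS_reach]
  simp only [encode, Fin.append_right]

end VASS

theorem sectionAlong_reach_mem_secReachVAS {d D : ℕ} (V : VASS D) (q : V.Q) (ι : Fin d ↪o Fin D)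
    (u : Fin D → ℕ) : (⟨d, sectionAlong ι u (V.reach q)⟩ : VecSet) ∈ SecReachVAS := by
  rw [V.reach_eq_sectionAlong, sectionAlong_sectionAlong]
  exact sectionAlong_mem_secReachVAS _ _ _

theorem reachVASS_subset_secReachVAS : ReachVASS ⊆ SecReachVAS := by
  rintro _ ⟨d, V, q, rfl⟩
  rw [V.reach_eq_sectionAlong]
  exact sectionAlong_mem_secReachVAS _ _ _

theorem reachVAS_subset_reachVASS : ReachVAS ⊆ ReachVASS := by
  rintro _ ⟨d, V, rfl⟩
  let W : VASS d := ⟨Unit, inferInstance, ((), V.source),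
    V.transitions.map ⟨fun t => ((), t, ()), fun _ _ h => congrArg (fun x => x.2.1) h⟩⟩
  have hstep : ∀ v w, W.Step ((), v) ((), w) ↔ V.Step v w := fun v w =>
    exists_congr fun t => and_congr_left' (Finset.mem_map' (a := t) _)
  refine ⟨d, W, (), congrArg (Sigma.mk d) (Set.ext fun v => ⟨fun h => ?_, fun h => ?_⟩)⟩
  · exact ReflTransGen.lift (fun v => ((), v)) (fun v w => (hstep v w).2) _ _ h
  · exact ReflTransGen.lift (r := W.Step) Prod.snd (fun c c' => (hstep c.2 c'.2).1) _ _ h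

theorem finite_mem_reachVASS {d : ℕ} {S : Set (Fin d → ℕ)} (hS : S.Finite) :
    (⟨d, S⟩ : VecSet) ∈ ReachVASS := by
  let V : VASS d := ⟨Bool, inferInstance, (false, 0),
    (hS.image fun v => (false, fun i => (v i : ℤ), true)).toFinset⟩
  have htransition : ∀ b t b', (b, t, b') ∈ V.transitions ↔
      ∃ v ∈ S, (false, fun i => (v i : ℤ), true) = (b, t, b') := fun b t b' => by
    simp only [V, Set.Finite.mem_toFinset, Set.mem_image]
  refine ⟨d, V, true, congrArg (Sigma.mk d) (Set.ext fun v => ⟨fun hv => ?_, fun h => ?_⟩)⟩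
  · exact .single ⟨_, (htransition _ _ _).2 ⟨v, hv, rfl⟩, fun i => zero_add _⟩
  · have hrun : ∀ c, ReflTransGen V.Step V.source c → c = (false, 0) ∨ c.1 = true ∧ c.2 ∈ S := by
      intro c hc
      induction hc with
      | refl => exact Or.inl rfl
      | @tail c c' _ hs ih =>
        obtain ⟨q', w⟩ := c'
        obtain ⟨t, ht, hs⟩ := hs
        obtain ⟨u, hu, htu⟩ := (htransition _ _ _).1 ht
        obtain ⟨hq, rfl, rfl⟩ : false = c.1 ∧ (fun i => (u i : ℤ)) = t ∧ true = q' := by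
          simpa only [Prod.mk.injEq] using htu
        obtain rfl : c = (false, 0) := ih.resolve_right fun h => by simp [← hq] at h
        obtain rfl : w = u := hs.right_unique fun i => zero_add _
        exact Or.inr ⟨rfl, hu⟩
    exact ((hrun _ h).resolve_left (by simp)).2

theorem one_two_notMem_reachVAS : (⟨1, {1, 2}⟩ : VecSet) ∉ ReachVAS := by
  rintro ⟨d, V, h⟩
  obtain ⟨rfl, h⟩ := Sigma.mk.inj_iff.1 h
  replace h : V.reach = {1, 2} := (eq_of_heq h).symm
  have hreach : ∀ w, w ∈ V.reach ↔ w 0 = 1 ∨ w 0 = 2 := fun w => by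
    simp [h, funext_iff]
  have hstep : ∀ v ∈ V.reach, ∀ w, V.Step v w → v = w := by
    rintro v hv w ⟨t, ht, hs⟩
    have happly : ∀ n m : ℕ, (n = 1 ∨ n = 2) → (n : ℤ) + t 0 = m → m = 1 ∨ m = 2 :=
      fun n m hn hm => (hreach fun _ => m).1 <| ((hreach fun _ => n).2 hn).tail
        ⟨t, ht, fun i => by rwa [Subsingleton.elim i 0]⟩
    have hone : t 0 ≠ 1 := fun ht₀ => by simpa using happly 2 3 (Or.inr rfl) (by omega)
    have hneg : t 0 ≠ -1 := fun ht₀ => by simpa using happly 1 0 (Or.inl rfl) (by omega)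
    have hv₀ := (hreach v).1 hv
    have hw₀ := (hreach w).1 (hv.tail ⟨t, ht, hs⟩)
    have hs₀ := hs 0
    refine funext fun i => ?_
    rw [Subsingleton.elim i 0]
    omega
  have hsource : ∀ v ∈ V.reach, V.source = v := fun v hv => by
    induction hv with
    | refl => rfl
    | tail hv hs ih => exact ih.trans (hstep _ hv _ hs)
  have heq := (hsource 1 ((hreach 1).2 (Or.inl rfl))).symm.trans
    (hsource 2 ((hreach 2).2 (Or.inr rfl)))
  exact absurd (congrFun heq 0) (by simp)

namespace VASS

theorem run_of_loop {d : ℕ} {V : VASS d} {q : V.Q} {t : Fin d → ℤ} {v w : Fin d → ℕ} {k : ℕ}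
    (ht : (q, t, q) ∈ V.transitions) (h : VecStep v (k • t) w) :
    ReflTransGen V.Step (q, v) (q, w) := by
  have hnonneg : ∀ j ≤ k, ∀ i, 0 ≤ v i + j * t i := fun j hj i =>
    le_add_mul_of_le_endpoints hj (v i).cast_nonneg (by simpa using (h i).symm ▸ (w i).cast_nonneg)
  have hrun : ∀ j ≤ k,
      ReflTransGen V.Step (q, v) (q, fun i => (v i + j * t i).toNat) := fun j hj => by
    induction j with
    | zero => simpa using ReflTransGen.refl
    | succ j ih =>
      refine (ih (by omega)).tail ⟨t, ht, fun i => ?_⟩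
      rw [Int.toNat_of_nonneg (hnonneg _ (by omega) i), Int.toNat_of_nonneg (hnonneg _ hj i)]
      push_cast
      ring
  convert hrun k le_rfl with i
  have hw : (v i : ℤ) + k * t i = w i := by simpa using h i
  rw [hw, Int.toNat_natCast]

end VASS

/-- While its first counter is `n`, this VASS can at most double the sum of the other two. -/
def doublingVASS : VASS 3 where
  Q := Bool
  finiteStates := inferInstance
  source := (false, 0)
  transitions := {(false, ![0, -1, 2], false), (false, 0, true), (true, ![0, 1, -1], true),
    (true, ![1, 1, 0], false)}

namespace doublingVASS

theorem mem_transitions {q q' : Bool} {t : Fin 3 → ℤ} :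
    (q, t, q') ∈ doublingVASS.transitions ↔
      q = false ∧ t = ![0, -1, 2] ∧ q' = false ∨ q = false ∧ t = 0 ∧ q' = true ∨
        q = true ∧ t = ![0, 1, -1] ∧ q' = true ∨ q = true ∧ t = ![1, 1, 0] ∧ q' = false := by
  change (q, t, q') ∈ ({_, _, _, _} : Finset (Bool × (Fin 3 → ℤ) × Bool)) ↔ _
  simp only [Finset.mem_insert, Finset.mem_singleton, Prod.mk.injEq]

theorem invariant {c : Bool × (Fin 3 → ℕ)}
    (h : ReflTransGen doublingVASS.Step doublingVASS.source c) :
    c.2 0 ≤ c.2 1 + c.2 2 ∧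
      (bif c.1 then c.2 1 + c.2 2 else 2 * c.2 1 + c.2 2) + 2 ≤ 2 ^ (c.2 0 + 1) := by
  induction h with
  | refl => simp [doublingVASS]
  | @tail c c' _ hs ih =>
    obtain ⟨q, v⟩ := c
    obtain ⟨q', w⟩ := c'
    obtain ⟨t, ht, hs⟩ := hs
    obtain ⟨h₀, h₁, h₂⟩ := (Fin.forall_fin_succ.trans (and_congr_right' Fin.forall_fin_two)).1 hs
    rcases mem_transitions.1 ht with
      ⟨rfl, rfl, rfl⟩ | ⟨rfl, rfl, rfl⟩ | ⟨rfl, rfl, rfl⟩ | ⟨rfl, rfl, rfl⟩ <;>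
      simp only [cond_true, cond_false] at ih ⊢
    · have hw : w 0 = v 0 := by simpa using h₀.symm
      rw [hw]
      simp at h₁ h₂
      omega
    · have hw : w 0 = v 0 := by simpa using h₀.symm
      rw [hw]
      simp at h₁ h₂
      omega
    · have hw : w 0 = v 0 := by simpa using h₀.symm
      rw [hw]
      simp at h₁ h₂
      omega
    · have hw : w 0 = v 0 + 1 := by zify; simpa using h₀.symm
      have hpow : 2 ^ (w 0 + 1) = 2 * 2 ^ (v 0 + 1) := by rw [hw, pow_succ']
      simp at h₁ h₂
      omega

theorem succ_mem_reach {x y : ℕ} (h : ![x, y, 0] ∈ doublingVASS.reach false) :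
    ![x + 1, 2 * y + 1, 0] ∈ doublingVASS.reach false := by
  have hdouble : ReflTransGen doublingVASS.Step (false, ![x, y, 0]) (false, ![x, 0, 2 * y]) :=
    VASS.run_of_loop (k := y) (mem_transitions.2 (Or.inl ⟨rfl, rfl, rfl⟩)) fun i => by
      fin_cases i <;> simp [mul_comm]
  have hswitch : doublingVASS.Step (false, ![x, 0, 2 * y]) (true, ![x, 0, 2 * y]) :=
    ⟨0, mem_transitions.2 (by simp), fun i => add_zero _⟩
  have htransfer : ReflTransGen doublingVASS.Step (true, ![x, 0, 2 * y]) (true, ![x, 2 * y, 0]) :=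
    VASS.run_of_loop (t := ![0, 1, -1]) (k := 2 * y) (mem_transitions.2 (by simp)) fun i => by
      fin_cases i <;> simp
  have hback : doublingVASS.Step (true, ![x, 2 * y, 0]) (false, ![x + 1, 2 * y + 1, 0]) :=
    ⟨![1, 1, 0], mem_transitions.2 (by simp), fun i => by fin_cases i <;> simp⟩
  exact (((h.trans hdouble).tail hswitch).trans htransfer).tail hback

end doublingVASS

/-- The part of the reachability set of `doublingVASS` where the last counter is zero: a set with
finite fibres over both axes, but with exponential growth. -/
def doublingSet : Set (Fin 2 → ℕ) :=
  sectionAlong (Fin.castAddOrderEmb 1) 0 (doublingVASS.reach false)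

theorem mem_doublingSet_iff {v : Fin 2 → ℕ} :
    v ∈ doublingSet ↔ ![v 0, v 1, 0] ∈ doublingVASS.reach false := by
  rw [doublingSet, mem_sectionAlong_castAdd]
  congr!
  ext i
  fin_cases i <;> rfl

theorem le_and_lt_of_mem_doublingSet {v : Fin 2 → ℕ} (hv : v ∈ doublingSet) :
    v 0 ≤ v 1 ∧ v 1 < 2 ^ v 0 := by
  have h := doublingVASS.invariant (mem_doublingSet_iff.1 hv)
  simp at h
  omega

theorem two_pow_sub_one_mem_doublingSet (n : ℕ) : ![n, 2 ^ n - 1] ∈ doublingSet := by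
  refine mem_doublingSet_iff.2 ?_
  change ![n, 2 ^ n - 1, 0] ∈ doublingVASS.reach false
  induction n with
  | zero =>
    have : (![0, 2 ^ 0 - 1, 0] : Fin 3 → ℕ) = 0 := by ext i; fin_cases i <;> rfl
    exact this ▸ .refl
  | succ n ih =>
    convert doublingVASS.succ_mem_reach ih using 3
    have := Nat.one_le_two_pow (n := n)
    omega

theorem finite_setOf_mem_doublingSet (i : Fin 2) (x : ℕ) :
    {v ∈ doublingSet | v i = x}.Finite := by
  refine (Set.finite_Iic ![x, 2 ^ x]).subset fun v ⟨hv, hx⟩ => ?_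
  obtain ⟨h₁, h₂⟩ := le_and_lt_of_mem_doublingSet hv
  refine Pi.le_def.2 (Fin.forall_fin_two.2 ?_)
  obtain rfl | rfl := Fin.exists_fin_two.1 ⟨i, rfl⟩
  · exact ⟨hx.le, hx ▸ h₂.le⟩
  · exact ⟨hx ▸ h₁, hx.le.trans Nat.lt_two_pow_self.le⟩

theorem exists_mul_add_lt_two_pow (A C : ℕ) : ∃ n, A * n + C < 2 ^ n := by
  refine ⟨2 * (2 * A + C), ?_⟩
  have hlt : 2 * A + C + 1 ≤ 2 ^ (2 * A + C) := Nat.lt_two_pow_self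
  calc A * (2 * (2 * A + C)) + C < (2 * A + C + 1) * (2 * A + C + 1) := by nlinarith
    _ ≤ 2 ^ (2 * A + C) * 2 ^ (2 * A + C) := Nat.mul_le_mul hlt hlt
    _ = 2 ^ (2 * (2 * A + C)) := by rw [← pow_add, ← two_mul (2 * A + C)]

theorem doublingSet_notMem_reachVASS : (⟨2, doublingSet⟩ : VecSet) ∉ ReachVASS := by
  rintro ⟨d, V, q, h⟩
  obtain ⟨rfl, h⟩ := Sigma.mk.inj_iff.1 h
  replace h : doublingSet = V.reach q := eq_of_heq h
  obtain ⟨A, C, hle⟩ := VASS.exists_linear_bound fun i x => h ▸ finite_setOf_mem_doublingSet i x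
  obtain ⟨n, hn⟩ := exists_mul_add_lt_two_pow A (C + 1)
  have : 2 ^ n - 1 ≤ A * n + C := hle _ (h ▸ two_pow_sub_one_mem_doublingSet n)
  omega

theorem mainTheorem11 :
    ReachVAS ⊂ ReachVASS ∧ ReachVASS ⊂ SecReachVAS ∧
      (∃ (d : ℕ) (S : Set (Fin d → ℕ)), S.Nonempty ∧
        (⟨d, S⟩ : VecSet) ∈ ReachVASS ∧ (⟨d, S⟩ : VecSet) ∉ ReachVAS) := by
  have hmem : (⟨1, {1, 2}⟩ : VecSet) ∈ ReachVASS := finite_mem_reachVASS (Set.toFinite _)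
  exact ⟨⟨reachVAS_subset_reachVASS, fun h => one_two_notMem_reachVAS (h hmem)⟩,
    ⟨reachVASS_subset_secReachVAS, fun h =>
      doublingSet_notMem_reachVASS (h (sectionAlong_reach_mem_secReachVAS _ _ _ _))⟩,
    1, {1, 2}, ⟨1, Or.inl rfl⟩, hmem, one_two_notMem_reachVAS⟩
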